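/- For $\gamma\in(0,\infty)$ and $x\in\mathbb{R}$ let $\gamma^x\in(0,\infty)$ be the real power, and for $\gamma\neq 1$ let $\log_\gamma:(0,\infty)\to\mathbb{R}$ be the inverse of $x\mapsto\gamma^x$. For $x\in(0,\infty)$ let $\ln x=\int_1^x\frac{dt}{t}$. 1. Let $f$ be a continuous monoid homomorphism from $(0,\infty)$ under multiplication to $\mathbb{R}$ under addition. Then $f(\gamma^x)=x\,f(\gamma)$ for all $x\in\mathbb{R}$ and $\gamma\in(0,\infty)$. If $\gamma\in(0,\infty)$ and $\gamma\neq1$, then $f(x)=f(\gamma)\log_\gamma x$ for all $x\in(0,\infty)$. 2. The map $\ln$ is a continuous monoid homomorphism from $((0,\infty),\times)$ to $(\mathbb{R},+)$. Consequently $\ln(\gamma^x)=x\ln\gamma$ for all $x\in\mathbb{R}$ and $\gamma\in(0,\infty)$, and $\ln x=\ln\gamma\,\log_\gamma x$ for all $x,\gamma\in(0,\infty)$ with $\gamma\neq1$. Moreover, there is a unique $e\in(0,\infty)$ with $\ln e=1$; it satisfies $e\neq1$, and $\ln=\log_e$. -/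

import Mathlib

/-- The space `(0,∞)` of positive reals: the subspace topology, and the monoid structure given by
multiplication. -/
abbrev PosReal : Type := {x : ℝ // 0 < x}

/-- Real exponentiation `γ ^ x`, for a positive base `γ` and a real exponent `x`, as a map into
`(0,∞)`. -/
noncomputable def expBase (γ : PosReal) (x : ℝ) : PosReal :=
  ⟨(γ : ℝ) ^ x, Real.rpow_pos_of_pos γ.2 x⟩

theorem expBase_bijective (γ : PosReal) (hγ : γ ≠ 1) : Function.Bijective (expBase γ) := by
  have h1 : (γ : ℝ) ≠ 1 := fun h => hγ (Subtype.ext h)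
  refine ⟨fun x y h => ?_, fun y => ⟨Real.logb γ y, Subtype.ext ?_⟩⟩
  · have h' : (γ : ℝ) ^ x = (γ : ℝ) ^ y := congrArg Subtype.val h
    rw [← Real.logb_rpow γ.2 h1 (x := x), h', Real.logb_rpow γ.2 h1]
  · exact Real.rpow_logb γ.2 h1 y.2

/-- The logarithm `log_γ : (0,∞) → ℝ` to a positive base `γ ≠ 1`: the inverse of `x ↦ γ ^ x`. -/
noncomputable def logBase (γ : PosReal) (hγ : γ ≠ 1) : PosReal → ℝ :=
  (Equiv.ofBijective (expBase γ) (expBase_bijective γ hγ)).symm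

/-- The natural logarithm, `ln x = ∫ t from 1 to x of dt / t` (for `x < 1` this is minus the
integral over `[x, 1]`). -/
noncomputable def natLog (x : PosReal) : ℝ :=
  ∫ t in (1 : ℝ)..(x : ℝ), 1 / t

/-- The integral that defines `natLog` is a genuine one. -/
theorem natLog_intervalIntegrable (x : PosReal) :
    IntervalIntegrable (fun t : ℝ => 1 / t) MeasureTheory.volume 1 (x : ℝ) :=
  intervalIntegral.intervalIntegrable_one_div
    (fun t ht h => by
      rw [h] at ht
      exact Set.notMem_uIcc_of_lt one_pos x.2 ht)
    continuousOn_id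

/-!
For a continuous homomorphism `f`, the map `x ↦ f (γ ^ x)` is continuous and additive on `ℝ`, hence
`ℝ`-linear, so it is determined by its value `f γ` at `1`. Writing `x = γ ^ log_γ x` turns this
into the formula for `f x`. By the fundamental theorem of calculus the integral `ln` is the inverse
of the exponential function, so it is one such `f`, and a bijective one; for `ln e = 1` the formula
for `f x` reads `ln = log_e`.
-/

/-- The one-parameter subgroup `x ↦ γ ^ x` of `(0,∞)`; its source is `(ℝ, +)`, written
multiplicatively. -/
noncomputable def expBaseHom (γ : PosReal) : Multiplicative ℝ →ₜ* PosReal where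
  toFun x := expBase γ x.toAdd
  map_one' := Subtype.ext (Real.rpow_zero _)
  map_mul' x y := Subtype.ext (Real.rpow_add γ.2 x.toAdd y.toAdd)
  continuous_toFun :=
    ((Real.continuous_const_rpow γ.2.ne').subtype_mk _).comp continuous_toAdd

theorem expBase_one (γ : PosReal) : expBase γ 1 = γ :=
  Subtype.ext (Real.rpow_one _)

theorem expBase_logBase (γ : PosReal) (hγ : γ ≠ 1) (x : PosReal) :
    expBase γ (logBase γ hγ x) = x :=
  (Equiv.ofBijective (expBase γ) (expBase_bijective γ hγ)).apply_symm_apply x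

section ContinuousHom

variable {E : Type*} [AddCommGroup E] [Module ℝ E] [TopologicalSpace E] [ContinuousSMul ℝ E]
  [T2Space E]

theorem toAdd_map_expBase (f : PosReal →ₜ* Multiplicative E) (γ : PosReal) (x : ℝ) :
    (f (expBase γ x)).toAdd = x • (f γ).toAdd := by
  let g : ℝ →+ E := AddMonoidHom.toMultiplicative.symm (f.comp (expBaseHom γ)).toMonoidHom
  have g_apply (y : ℝ) : g y = (f (expBase γ y)).toAdd := rfl
  have g_continuous : Continuous g :=
    continuous_toAdd.comp ((f.comp (expBaseHom γ)).continuous_toFun.comp continuous_ofAdd)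
  calc (f (expBase γ x)).toAdd = g (x • 1) := by rw [smul_eq_mul, mul_one, g_apply]
    _ = x • g 1 := map_real_smul g g_continuous x 1
    _ = x • (f γ).toAdd := by rw [g_apply, expBase_one]

theorem toAdd_map_eq_logBase_smul (f : PosReal →ₜ* Multiplicative E) (γ : PosReal) (hγ : γ ≠ 1)
    (x : PosReal) : (f x).toAdd = logBase γ hγ x • (f γ).toAdd := by
  rw [← toAdd_map_expBase, expBase_logBase]

end ContinuousHom

theorem natLog_eq_log (x : PosReal) : natLog x = Real.log x := by
  rw [natLog, integral_one_div_of_pos one_pos x.2, div_one]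

theorem natLog_one : natLog 1 = 0 :=
  intervalIntegral.integral_same

theorem natLog_mul (x y : PosReal) : natLog (x * y) = natLog x + natLog y := by
  simp only [natLog_eq_log, Positive.val_mul, Real.log_mul x.2.ne' y.2.ne']

theorem continuous_natLog : Continuous natLog := by
  rw [funext natLog_eq_log]
  exact continuous_subtype_val.log fun x => x.2.ne'

theorem natLog_bijective : Function.Bijective natLog := by
  rw [funext natLog_eq_log]
  exact ⟨fun x y h => Subtype.ext (Real.log_injOn_pos x.2 y.2 h),
    fun y => ⟨⟨Real.exp y, Real.exp_pos y⟩, Real.log_exp y⟩⟩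

/-- `ln` as a homomorphism of topological monoids; its target is `(ℝ, +)`, written
multiplicatively. -/
noncomputable def natLogHom : PosReal →ₜ* Multiplicative ℝ where
  toFun x := Multiplicative.ofAdd (natLog x)
  map_one' := congrArg Multiplicative.ofAdd natLog_one
  map_mul' x y := congrArg Multiplicative.ofAdd (natLog_mul x y)
  continuous_toFun := continuous_ofAdd.comp continuous_natLog

theorem natLog_expBase (γ : PosReal) (x : ℝ) : natLog (expBase γ x) = x * natLog γ :=
  toAdd_map_expBase natLogHom γ x

theorem natLog_eq_mul_logBase (γ : PosReal) (hγ : γ ≠ 1) (x : PosReal) :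
    natLog x = natLog γ * logBase γ hγ x :=
  (toAdd_map_eq_logBase_smul natLogHom γ hγ x).trans (mul_comm _ _)

theorem ne_one_of_natLog_eq_one {e : PosReal} (he : natLog e = 1) : e ≠ 1 := by
  rintro rfl
  exact zero_ne_one (natLog_one.symm.trans he)

theorem natLog_eq_logBase {e : PosReal} (he : natLog e = 1) :
    natLog = logBase e (ne_one_of_natLog_eq_one he) := by
  funext x
  rw [natLog_eq_mul_logBase e (ne_one_of_natLog_eq_one he), he, one_mul]

theorem proposition6p2_general (E : Type*) [AddCommGroup E] [Module ℝ E] [TopologicalSpace E]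
    [ContinuousSMul ℝ E] [T2Space E] :
    (∀ f : PosReal →ₜ* Multiplicative E,
      (∀ (γ : PosReal) (x : ℝ), (f (expBase γ x)).toAdd = x • (f γ).toAdd) ∧
      (∀ (γ : PosReal) (hγ : γ ≠ 1) (x : PosReal),
        (f x).toAdd = logBase γ hγ x • (f γ).toAdd)) ∧
    (∃ f : PosReal →ₜ* Multiplicative ℝ, ∀ x : PosReal, (f x).toAdd = natLog x) ∧
    (∀ (γ : PosReal) (x : ℝ), natLog (expBase γ x) = x * natLog γ) ∧
    (∀ (γ : PosReal) (hγ : γ ≠ 1) (x : PosReal), natLog x = natLog γ * logBase γ hγ x) ∧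
    (∃! e : PosReal, natLog e = 1) ∧
    (∀ e : PosReal, natLog e = 1 → ∃ he : e ≠ 1, natLog = logBase e he) :=
  ⟨fun f => ⟨toAdd_map_expBase f, toAdd_map_eq_logBase_smul f⟩,
    ⟨natLogHom, fun _ => rfl⟩,
    natLog_expBase,
    natLog_eq_mul_logBase,
    natLog_bijective.existsUnique 1,
    fun _ he => ⟨ne_one_of_natLog_eq_one he, natLog_eq_logBase he⟩⟩

theorem proposition6p2 :
    -- every homomorphism of topological monoids from `((0,∞), ×)` to `(ℝ, +)`
    (∀ f : PosReal →ₜ* Multiplicative ℝ,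
      (∀ (γ : PosReal) (x : ℝ), (f (expBase γ x)).toAdd = x * (f γ).toAdd) ∧
      (∀ (γ : PosReal) (hγ : γ ≠ 1) (x : PosReal),
        (f x).toAdd = (f γ).toAdd * logBase γ hγ x)) ∧
    -- `ln` is such a homomorphism
    (∃ f : PosReal →ₜ* Multiplicative ℝ, ∀ x : PosReal, (f x).toAdd = natLog x) ∧
    (∀ (γ : PosReal) (x : ℝ), natLog (expBase γ x) = x * natLog γ) ∧
    (∀ (γ : PosReal) (hγ : γ ≠ 1) (x : PosReal), natLog x = natLog γ * logBase γ hγ x) ∧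
    -- there is a unique `e` with `ln e = 1`; it is not `1`, and `ln = log_e`
    (∃! e : PosReal, natLog e = 1) ∧
    (∀ e : PosReal, natLog e = 1 → ∃ he : e ≠ 1, natLog = logBase e he) := by
  simpa only [smul_eq_mul, mul_comm (logBase _ _ _)] using proposition6p2_general ℝ
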